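/- Let $p$ be an odd prime and let $m,\ell$ be positive integers such that $m_\ell := m/(m,\ell)$ is even and $m>6\ell$, where $(m,\ell)$ denotes the greatest common divisor. Put $\delta=(m,\ell)$ and $\varepsilon_\ell=(-1)^{m_\ell/2}$. Let $\mathcal{L}_{\ell,3\ell}=\langle x^{p^\ell},x^{p^{3\ell}}\rangle$ be the $\mathbb{F}_{p^m}$-subspace of $\mathbb{F}_{p^m}[x]$ spanned by $x^{p^\ell}$ and $x^{p^{3\ell}}$, and consider the linear code over $\mathbb{F}_p$ of length $p^m-1$ $$\mathcal{C}_{\mathcal{L}_{\ell,3\ell}}=\Big\{\big(\mathrm{Tr}_{\mathbb{F}_{p^m}/\mathbb{F}_p}(xR(x))\big)_{x\in\mathbb{F}_{p^m}^*} : R\in\mathcal{L}_{\ell,3\ell}\Big\}.$$ For a linear code $\mathcal{C}\subseteq\mathbb{F}_p^n$, with the elements of $\mathbb{F}_p$ listed as $\omega_0=0,\omega_1,\ldots,\omega_{p-1}$, the complete weight enumerator is $$W_{\mathcal{C}}(z_0,\ldots,z_{p-1})=\sum_{t_0+\cdots+t_{p-1}=n}A(t_0,\ldots,t_{p-1})\,z_0^{t_0}\cdots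 z_{p-1}^{t_{p-1}},$$ where the sum is over nonnegative integers $t_i$ and $A(t_0,\ldots,t_{p-1})$ is the number of codewords in $\mathcal{C}$ having, for every $i$, exactly $t_i$ coordinates equal to $\omega_i$. Then $$W_{\mathcal{C}_{\mathcal{L}_{\ell,3\ell}}}(z_0,\ldots,z_{p-1})=z_0^{p^m-1}+\sum_{i=0}^{3}F_i\,z_0^{a_i}z_1^{b_i}\cdots z_{p-1}^{b_i},$$ where, for $i=0,\ldots,3$, the numbers $$a_i=p^{m-1}+(-1)^i\varepsilon_\ell(p-1)p^{\frac m2+i\delta-1}-1,\qquad b_i=p^{m-1}+(-1)^{i+1}\varepsilon_\ell\,p^{\frac m2+i\delta-1}$$ are nonnegative integers and, with $D=p^{6\delta}+p^{5\delta}-p^{4\delta}+p^{2\delta}-p^{\delta}-1$ and $\Sigma=\sum_{i=0}^{5}(-1)^{i+1}p^{i\delta}$, $$\begin{aligned} D F_0&=p^{2m+6\delta}-p^{2m+4\delta}-p^{2m+\delta}+p^{m+4\delta}+p^{m+\delta}-p^{6\delta}+\varepsilon_\ell\big(p^{\frac{3m}2+5\delta}-p^{\frac{3m}2+4\delta}-p^{\frac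 m2+5\delta}+p^{\frac m2+4\delta}\big),\\ D F_1&=p^{2m-2\delta}(p^{7\delta}-p^{2\delta}-1)+p^{m-2\delta}(p^{5\delta}-p^{6\delta}+p^{2\delta}+1)-p^{3\delta}(p^{2\delta}-p^{\delta}+1)-\varepsilon_\ell\big(p^{\frac{3m}2}-p^{\frac m2}\big)\Sigma,\\ D F_2&=p^{2m-3\delta}(p^{5\delta}+p^{\delta}-1)-p^{m-3\delta}(p^{6\delta}+p^{4\delta}+p^{\delta}-1)+p^{\delta}(p^{2\delta}-p^{\delta}+1)+\varepsilon_\ell\big(p^{\frac{3m}2-2\delta}-p^{\frac m2-2\delta}\big)\Sigma,\\ D F_3&=p^{2m-3\delta}-p^{m}-p^{m-3\delta}+1-\varepsilon_\ell\big(p^{\frac{3m}2-\delta}-p^{\frac{3m}2-2\delta}-p^{\frac m2-\delta}+p^{\frac m2-2\delta}\big). \end{aligned}$$ -/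

import Mathlib

open Polynomial

noncomputable section

namespace TraceCode

/-- The word `(Tr_{K/F}(x R(x)))` indexed by the nonzero elements `x` of `K`, as an `F`-linear
function of the polynomial `R ∈ K[X]`. -/
def word (F K : Type*) [Field F] [Field K] [Algebra F K] : K[X] →ₗ[F] (Kˣ → F) where
  toFun R := fun x => Algebra.trace F K ((x : K) * R.eval (x : K))
  map_add' R S := by
    funext x
    simp [mul_add]
  map_smul' c R := by
    funext x
    simp

/-- The code `C_L = { (Tr_{K/F}(x R(x)))_{x ∈ K^*} : R ∈ L }`, a linear code over `F`
whose coordinates are indexed by `K^*`. -/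
def code (F : Type*) {K : Type*} [Field F] [Field K] [Algebra F K]
    (L : Submodule K K[X]) : Submodule F (Kˣ → F) :=
  (L.restrictScalars F).map (word F K)

/-- The family `⟨x^{p^ℓ}, x^{p^{3ℓ}}⟩`, a `K`-subspace of `K[X]`. -/
def familyL (K : Type*) [Field K] (p ℓ : ℕ) : Submodule K K[X] :=
  Submodule.span K {(X : K[X]) ^ p ^ ℓ, (X : K[X]) ^ p ^ (3 * ℓ)}

/-- The composition of a word `v` over `F`: for each `a ∈ F`, the number of coordinates of `v`
equal to `a`. -/
def comp {ι F : Type*} [Fintype ι] [Fintype F] [DecidableEq F] (v : ι → F) : F →₀ ℕ :=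
  Finsupp.equivFunOnFinite.symm fun a => (Finset.univ.filter fun j => v j = a).card

/-- The complete weight enumerator of a linear code `C ⊆ F^ι`. The variables are indexed by
the elements of `F`; the sum runs over all `t : F → ℕ` with `∑ a, t a = n`, where `n` is the
length, and the coefficient of `∏ a, z_a ^ t a` is the number of codewords of
composition `t`. -/
def completeWeightEnumerator {ι F : Type*} [Fintype ι] [Field F] [Fintype F] [DecidableEq F]
    (C : Submodule F (ι → F)) : MvPolynomial F ℚ :=
  ∑ t ∈ Finset.finsuppAntidiag (Finset.univ : Finset F) (Fintype.card ι),
    MvPolynomial.monomial t (({c : ι → F | c ∈ C ∧ comp c = t}.ncard : ℕ) : ℚ)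

/-- `m_ℓ = m / (m, ℓ)`. -/
def mSub (m ℓ : ℕ) : ℕ := m / m.gcd ℓ

/-- `ε_ℓ = (-1)^{m_ℓ / 2}` (used for even `m_ℓ`). -/
def eps (m ℓ : ℕ) : ℤ := (-1) ^ (mSub m ℓ / 2)

/-- The common denominator `p^{6δ} + p^{5δ} - p^{4δ} + p^{2δ} - p^δ - 1` of the frequencies. -/
def freqDen (p δ : ℕ) : ℚ :=
  (p : ℚ) ^ (6 * δ) + (p : ℚ) ^ (5 * δ) - (p : ℚ) ^ (4 * δ) + (p : ℚ) ^ (2 * δ) - (p : ℚ) ^ δ - 1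

/-- The alternating sum `∑_{i=0}^{5} (-1)^{i+1} p^{iδ}`. -/
def altSum (p δ : ℕ) : ℚ :=
  ∑ i ∈ Finset.range 6, (-1) ^ (i + 1) * (p : ℚ) ^ (i * δ)

/-- The numerators of the frequencies, in terms of `p`, `m`, `δ` and the sign `ε`. -/
def freqNum (p m δ : ℕ) (ε : ℚ) : Fin 4 → ℚ :=
  let P : ℚ := p
  ![P ^ (2 * m + 6 * δ) - P ^ (2 * m + 4 * δ) - P ^ (2 * m + δ) + P ^ (m + 4 * δ) + P ^ (m + δ)
      - P ^ (6 * δ)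
      + ε * (P ^ (3 * (m / 2) + 5 * δ) - P ^ (3 * (m / 2) + 4 * δ)
        - P ^ (m / 2 + 5 * δ) + P ^ (m / 2 + 4 * δ)),
    P ^ (2 * m - 2 * δ) * (P ^ (7 * δ) - P ^ (2 * δ) - 1)
      + P ^ (m - 2 * δ) * (P ^ (5 * δ) - P ^ (6 * δ) + P ^ (2 * δ) + 1)
      - P ^ (3 * δ) * (P ^ (2 * δ) - P ^ δ + 1)
      - ε * (P ^ (3 * (m / 2)) - P ^ (m / 2)) * altSum p δ,
    P ^ (2 * m - 3 * δ) * (P ^ (5 * δ) + P ^ δ - 1)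
      - P ^ (m - 3 * δ) * (P ^ (6 * δ) + P ^ (4 * δ) + P ^ δ - 1)
      + P ^ δ * (P ^ (2 * δ) - P ^ δ + 1)
      + ε * (P ^ (3 * (m / 2) - 2 * δ) - P ^ (m / 2 - 2 * δ)) * altSum p δ,
    P ^ (2 * m - 3 * δ) - P ^ m - P ^ (m - 3 * δ) + 1
      - ε * (P ^ (3 * (m / 2) - δ) - P ^ (3 * (m / 2) - 2 * δ)
        - P ^ (m / 2 - δ) + P ^ (m / 2 - 2 * δ))]

/-- The frequencies `F_0, F_1, F_2, F_3`, with `δ = (m, ℓ)`. -/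
def freq (p m ℓ : ℕ) (i : Fin 4) : ℚ :=
  freqNum p m (m.gcd ℓ) (eps m ℓ) i / freqDen p (m.gcd ℓ)

/-- `a_i = p^{m-1} + (-1)^i ε_ℓ (p-1) p^{m/2 + i(m,ℓ) - 1} - 1`. -/
def expA (p m ℓ : ℕ) (i : Fin 4) : ℤ :=
  (p : ℤ) ^ (m - 1)
    + (-1) ^ (i : ℕ) * eps m ℓ * ((p : ℤ) - 1) * (p : ℤ) ^ (m / 2 + (i : ℕ) * m.gcd ℓ - 1) - 1

/-- `b_i = p^{m-1} + (-1)^{i+1} ε_ℓ p^{m/2 + i(m,ℓ) - 1}`. -/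
def expB (p m ℓ : ℕ) (i : Fin 4) : ℤ :=
  (p : ℤ) ^ (m - 1)
    + (-1) ^ ((i : ℕ) + 1) * eps m ℓ * (p : ℤ) ^ (m / 2 + (i : ℕ) * m.gcd ℓ - 1)

end TraceCode

end

/-!
The automorphism `σ(x) = x^(q^ℓ)` of `K` over `F = 𝔽_q` generates a cyclic group of order
`2N = m_ℓ` with fixed field of order `Q = q^δ`. The codewords are the value tables of the
quadratic forms `Tr(a x σ(x) + b x σ³(x))`. Such a form is scaled by `c` in `F` under
multiplication by any `u` with `u σ(u) = c`, so it takes all nonzero values equally often, and its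
value distribution is determined by one integer, the excess of the number of zeros over the number
of points with value `1`, which is also the exponential sum of the form.

The square of the excess is `|K|` times the order of the radical. The radical is a vector space
over the fixed field of `σ²`, and it is the kernel of a cubic polynomial in `σ²`, so it has order
`Q^(2i)` with `i ≤ 3`. The group of solutions of `u σ(u) = 1`, of order `Q + 1`, acts freely on the
nonzero points of each level set; hence the excess is `1` modulo `Q + 1`, which fixes its sign: it
is `(-Q)^(N+i)`.

The number of forms for each `i` follows from the moments of order `0, …, 3` of the excess. The
`k`-th moment counts the vectors of `K^k` orthogonal to their images under `σ` and `σ³`; for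
`k = 2, 3` such a vector is, up to a scalar, defined over the fixed field of `σ²`, and the count is
that of the points of a Hermitian variety.
-/

noncomputable section

namespace TraceCode

open Finset

@[to_additive]
theorem card_monoidHom_ker_comp {G H M : Type*} [Group G] [Group H] [Group M]
    (f : G →* H) (g : H →* M) :
    Nat.card (g.comp f).ker = Nat.card f.ker * Nat.card ↥(f.range ⊓ g.ker) := by
  have hker : Nat.card (f.domRestrict (g.comp f).ker).ker = Nat.card f.ker := by
    rw [MonoidHom.ker_domRestrict]
    refine Nat.card_congr (Subgroup.subgroupOfEquivOfLe fun x hx => ?_).toEquiv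
    simp [MonoidHom.mem_ker, MonoidHom.mem_ker.1 hx]
  have hrange : (f.domRestrict (g.comp f).ker).range = f.range ⊓ g.ker := by
    rw [MonoidHom.domRestrict_range, ← MonoidHom.comap_ker, Subgroup.map_comap_eq]
  rw [← hrange, ← hker, ← Subgroup.index_ker, Subgroup.card_mul_index]

section FixedPoints

variable {F K : Type*} [Field F] [Field K] [Fintype K] [DecidableEq K] [Algebra F K]

theorem card_fixed_pow_orderOf (τ : K ≃ₐ[F] K) :
    #{x : K | τ x = x} ^ orderOf τ = Fintype.card K := by
  have := Finite.of_injective _ (algebraMap F K).injective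
  have hfix : #{x : K | τ x = x} =
      Nat.card (IntermediateField.fixedField (Subgroup.zpowers τ)) := by
    rw [← Fintype.card_subtype, ← Nat.card_eq_fintype_card]
    refine Nat.card_congr (Equiv.subtypeEquivRight fun x => ?_)
    rw [IntermediateField.mem_fixedField_iff]
    refine ⟨fun hx => ?_, fun hx => hx τ (Subgroup.mem_zpowers τ)⟩
    exact (Subgroup.zpowers_le (H := MulAction.stabilizer (K ≃ₐ[F] K) x)).2 hx
  rw [hfix, ← Nat.card_zpowers, ← IntermediateField.finrank_fixedField_eq_card,
    ← Module.natCard_eq_pow_finrank, Nat.card_eq_fintype_card]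

variable {σ : K ≃ₐ[F] K} {Q N : ℕ}

theorem card_fixed_of_orderOf (hN : N ≠ 0) (hσ : orderOf σ = N) (hK : Fintype.card K = Q ^ N) :
    #{x : K | σ x = x} = Q :=
  Nat.pow_left_injective hN (by simpa only [hσ, hK] using card_fixed_pow_orderOf σ)

theorem card_fixed_sq_of_orderOf (hN : N ≠ 0) (hσ : orderOf σ = 2 * N)
    (hK : Fintype.card K = Q ^ (2 * N)) : #{x : K | σ (σ x) = x} = Q ^ 2 :=
  card_fixed_of_orderOf (σ := σ ^ 2) hN
    (by rw [orderOf_pow_of_dvd two_ne_zero ⟨N, hσ⟩, hσ, Nat.mul_div_cancel_left _ two_pos])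
    (by rw [hK, pow_mul])

end FixedPoints

section NormEquation

variable {F K : Type*} [Field F] [Field K] [Algebra F K] {σ : K ≃ₐ[F] K}

theorem sq_apply_eq_of_mul_apply_eq {u c : K} (hc : σ c = c) (hc0 : c ≠ 0)
    (hu : u * σ u = c) : σ (σ u) = u := by
  have h0 : σ u ≠ 0 := right_ne_zero_of_mul (hu ▸ hc0)
  apply mul_left_cancel₀ h0
  rw [← map_mul, hu, hc, ← hu, mul_comm]

theorem exists_apply_mul_eq_of_mul_apply_eq_one {v u : K} (hv : σ (σ v) = v) (hv' : σ v ≠ v)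
    (hu : u * σ u = 1) : ∃ w ≠ 0, u * σ w = w := by
  rcases eq_or_ne u (-1) with rfl | h
  · exact ⟨v - σ v, sub_ne_zero.2 hv'.symm, by rw [map_sub, hv]; ring⟩
  · exact ⟨1 + u, fun h0 => h (eq_neg_of_add_eq_zero_right h0),
      by rw [map_add, map_one]; linear_combination hu⟩

variable (σ) in
/-- The twisted norm `u ↦ u σ(u)` on units. -/
def unitsNorm : Kˣ →* Kˣ := MonoidHom.id Kˣ * Units.map σ

variable (σ) in
/-- The quotient map `u ↦ u / σ(u)` on units, whose kernel is the group of units fixed by `σ`. -/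
def unitsQuot : Kˣ →* Kˣ := MonoidHom.id Kˣ / Units.map σ

theorem coe_unitsNorm (u : Kˣ) : (unitsNorm σ u : K) = u * σ u := rfl

theorem coe_unitsQuot (u : Kˣ) : (unitsQuot σ u : K) = u / σ u := by
  simp [unitsQuot]

theorem mem_ker_unitsNorm {u : Kˣ} : u ∈ (unitsNorm σ).ker ↔ (u : K) * σ u = 1 := by
  rw [MonoidHom.mem_ker, Units.ext_iff, coe_unitsNorm, Units.val_one]

theorem mem_ker_unitsQuot {u : Kˣ} : u ∈ (unitsQuot σ).ker ↔ σ (u : K) = u := by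
  rw [MonoidHom.mem_ker, Units.ext_iff, coe_unitsQuot, Units.val_one,
    div_eq_one_iff_eq (by simp), eq_comm]

theorem unitsQuot_comp_unitsNorm : (unitsQuot σ).comp (unitsNorm σ) = unitsQuot (σ ^ 2) := by
  ext u
  rw [MonoidHom.comp_apply, coe_unitsQuot, coe_unitsNorm, coe_unitsQuot, map_mul, mul_comm (σ _),
    mul_div_mul_right _ _ (by simp), pow_two, AlgEquiv.mul_apply]

theorem unitsNorm_comp_unitsQuot : (unitsNorm σ).comp (unitsQuot σ) = unitsQuot (σ ^ 2) := by
  rw [← unitsQuot_comp_unitsNorm]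
  ext u
  simp only [MonoidHom.comp_apply, coe_unitsQuot, coe_unitsNorm, map_mul, map_div₀]
  exact div_mul_div_comm _ _ _ _

variable [Fintype K] [DecidableEq K] {Q : ℕ}

theorem card_filter_units (P : K → Prop) [DecidablePred P] (h0 : ¬ P 0) :
    #{x : K | P x} = #{x : Kˣ | P x} := by
  rw [← card_map ⟨((↑) : Kˣ → K), Units.val_injective⟩]
  congr 1
  ext x
  simp only [mem_filter_univ, mem_map, Function.Embedding.coeFn_mk]
  exact ⟨fun hx => ⟨Units.mk0 x fun h => h0 (h ▸ hx), hx, rfl⟩, fun ⟨_, hu, h⟩ => h ▸ hu⟩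

variable (σ) in
theorem card_ker_unitsQuot_add_one : Nat.card (unitsQuot σ).ker + 1 = #{x : K | σ x = x} := by
  have h0 : (0 : K) ∈ univ.filter fun x => σ x = x := by simp
  rw [← card_erase_add_one h0, ← filter_ne', filter_filter, card_filter_units _ (by simp),
    Nat.card_eq_fintype_card, Fintype.card_subtype]
  simp only [mem_ker_unitsQuot, ne_eq, Units.ne_zero, not_false_eq_true, and_true]

/-- The norm equation `u σ(u) = c` has `Q + 1` solutions for each nonzero `c` fixed by `σ`. -/
def NormRegular (σ : K ≃ₐ[F] K) (Q : ℕ) : Prop :=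
  ∀ c : K, σ c = c → c ≠ 0 → #{u : K | u * σ u = c} = Q + 1

variable (h1 : #{x : K | σ x = x} = Q) (h2 : #{x : K | σ (σ x) = x} = Q ^ 2)
include h1 h2

theorem exists_sq_fixed_not_fixed : ∃ v : K, σ (σ v) = v ∧ σ v ≠ v := by
  have h01 : #({0, 1} : Finset K) ≤ #{x : K | σ x = x} :=
    card_le_card (by simp [insert_subset_iff])
  rw [card_pair zero_ne_one, h1] at h01
  have hlt : #{x : K | σ x = x} < #{x : K | σ (σ x) = x} := by
    rw [h1, h2]
    exact lt_self_pow₀ h01 one_lt_two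
  obtain ⟨v, hv, hv'⟩ := exists_mem_notMem_of_card_lt_card hlt
  exact ⟨v, (mem_filter.1 hv).2, fun h => hv' (mem_filter.2 ⟨mem_univ v, h⟩)⟩

theorem ker_unitsNorm_le_range_unitsQuot : (unitsNorm σ).ker ≤ (unitsQuot σ).range := by
  obtain ⟨v, hv, hv'⟩ := exists_sq_fixed_not_fixed h1 h2
  intro u hu
  obtain ⟨w, hw0, hw⟩ := exists_apply_mul_eq_of_mul_apply_eq_one hv hv'
    (mem_ker_unitsNorm.1 hu)
  refine ⟨Units.mk0 w hw0, Units.ext ?_⟩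
  rw [coe_unitsQuot, Units.val_mk0, div_eq_iff (by simpa using hw0), hw]

theorem card_ker_unitsNorm : Nat.card (unitsNorm σ).ker = Q + 1 := by
  have hQ := (card_ker_unitsQuot_add_one σ).trans h1
  have hQ2 : Nat.card (unitsQuot (σ ^ 2)).ker + 1 = Q ^ 2 :=
    (card_ker_unitsQuot_add_one (σ ^ 2)).trans h2
  have hcomp := card_monoidHom_ker_comp (unitsQuot σ) (unitsNorm σ)
  rw [unitsNorm_comp_unitsQuot, inf_eq_right.2 (ker_unitsNorm_le_range_unitsQuot h1 h2)] at hcomp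
  have hpos : 0 < Nat.card (unitsQuot σ).ker := Nat.card_pos
  apply Nat.eq_of_mul_eq_mul_left hpos
  rw [← hcomp]
  rw [← hQ] at hQ2 ⊢
  linarith

theorem ker_unitsQuot_le_range_unitsNorm : (unitsQuot σ).ker ≤ (unitsNorm σ).range := by
  have hcomp := card_monoidHom_ker_comp (unitsNorm σ) (unitsQuot σ)
  rw [unitsQuot_comp_unitsNorm, ← unitsNorm_comp_unitsQuot, card_monoidHom_ker_comp, mul_comm,
    inf_eq_right.2 (ker_unitsNorm_le_range_unitsQuot h1 h2)] at hcomp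
  have hcard := Nat.eq_of_mul_eq_mul_left Nat.card_pos hcomp
  exact inf_eq_right.1 (Subgroup.eq_of_le_of_card_ge inf_le_right hcard.le)

theorem normRegular_of_card_fixed : NormRegular σ Q := by
  intro c hc hc0
  have hmem : Units.mk0 c hc0 ∈ (unitsNorm σ).range :=
    ker_unitsQuot_le_range_unitsNorm h1 h2 (mem_ker_unitsQuot.2 hc)
  have hfiber := MonoidHom.card_fiber_eq_of_mem_range _ hmem (one_mem (unitsNorm σ).range)
  rw [card_filter_units _ (by simpa using hc0.symm), ← card_ker_unitsNorm h1 h2,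
    Nat.card_eq_fintype_card, Fintype.card_subtype]
  simpa only [Units.ext_iff, coe_unitsNorm, mem_ker_unitsNorm, Units.val_mk0, Units.val_one]
    using hfiber

end NormEquation

section SkewPolynomial

variable {K : Type*} [Field K]

/-- The additive operator `z ↦ ∑_{i ≤ n} c i τ^i(z)`, a polynomial of degree at most `n` in the
endomorphism `τ` with coefficients acting by multiplication. -/
def skewEval (τ : K →+* K) (c : ℕ → K) (n : ℕ) : K →+ K :=
  ∑ i ∈ range (n + 1), (AddMonoidHom.mulLeft (c i)).comp (τ ^ i : K →+* K)

theorem skewEval_apply (τ : K →+* K) (c : ℕ → K) (n : ℕ) (z : K) :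
    skewEval τ c n z = ∑ i ∈ range (n + 1), c i * τ^[i] z := by
  simp [skewEval, RingHom.coe_pow]

variable {τ : K →+* K} {c : ℕ → K} {n : ℕ} {z : K}

theorem skewEval_mul_of_root (hz : skewEval τ c (n + 1) z = 0) (w : K) :
    skewEval τ c (n + 1) (z * w) =
      -skewEval τ (fun i => ∑ j ∈ range (i + 1), c j * τ^[j] z) n (τ w - w) := by
  have hparts := sum_range_by_parts (fun i => τ^[i] w) (fun i => c i * τ^[i] z) (n + 1 + 1)
  rw [← skewEval_apply τ c (n + 1) z, hz, smul_zero, zero_sub] at hparts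
  simp only [skewEval_apply, iterate_map_mul, iterate_map_sub, ← Function.iterate_succ_apply]
  simpa only [smul_eq_mul, mul_comm, mul_left_comm, mul_assoc, add_tsub_cancel_right] using hparts

theorem exists_sum_range_ne_zero (hz : z ≠ 0) (hroot : skewEval τ c (n + 1) z = 0)
    (hc : ∃ i ≤ n + 1, c i ≠ 0) : ∃ i ≤ n, ∑ j ∈ range (i + 1), c j * τ^[j] z ≠ 0 := by
  by_contra! hzero
  obtain ⟨i, hi, hci⟩ := hc
  have hpartial : ∀ k ≤ n + 2, ∑ j ∈ range k, c j * τ^[j] z = 0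
    | 0, _ => sum_range_zero _
    | k + 1, hk => (Nat.lt_or_ge n k).elim
        (fun h => by rw [show k = n + 1 by omega, ← skewEval_apply, hroot]) (hzero k)
  have hterm : c i * τ^[i] z = 0 := by
    rw [← sum_range_succ_sub_sum (fun j => c j * τ^[j] z), hpartial _ (by omega),
      hpartial _ (by omega), sub_zero]
  have hiter : τ^[i] z ≠ 0 := fun h =>
    hz (τ.injective.iterate i (h.trans (iterate_map_zero τ i).symm))
  exact mul_ne_zero hci hiter hterm

theorem card_ker_skewEval_le [Finite K] (hc : ∃ i ≤ n, c i ≠ 0) :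
    Nat.card (skewEval τ c n).ker ≤ Nat.card {x : K // τ x = x} ^ n := by
  induction n generalizing c with
  | zero =>
    obtain ⟨i, hi, hci⟩ := hc
    obtain rfl : i = 0 := Nat.le_zero.1 hi
    have hbot : (skewEval τ c 0).ker = ⊥ := by
      refine (AddMonoidHom.ker_eq_bot_iff _).2 ((injective_iff_map_eq_zero _).2 fun z hz => ?_)
      simpa [skewEval_apply, hci] using hz
    simp [hbot]
  | succ n ih =>
    by_cases hbot : ∀ z, skewEval τ c (n + 1) z = 0 → z = 0
    · have : Nonempty {x : K // τ x = x} := ⟨0, map_zero τ⟩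
      rw [(AddMonoidHom.ker_eq_bot_iff _).2 ((injective_iff_map_eq_zero _).2 hbot)]
      simpa using Nat.one_le_pow _ _ Nat.card_pos
    · push Not at hbot
      obtain ⟨z, hz, hz0⟩ := hbot
      set d : ℕ → K := fun i => ∑ j ∈ range (i + 1), c j * τ^[j] z
      set D : K →+ K := (τ : K →+ K) - AddMonoidHom.id K
      have hker : Nat.card (skewEval τ c (n + 1)).ker = Nat.card ((skewEval τ d n).comp D).ker := by
        refine (Nat.card_congr (Equiv.subtypeEquiv (Equiv.mulLeft₀ z hz0) fun w => ?_)).symm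
        rw [AddMonoidHom.mem_ker, AddMonoidHom.mem_ker, Equiv.mulLeft₀_apply,
          skewEval_mul_of_root hz, neg_eq_zero]
        rfl
      have hfix : Nat.card D.ker = Nat.card {x : K // τ x = x} :=
        Nat.card_congr (Equiv.subtypeEquivRight fun x => sub_eq_zero)
      calc Nat.card (skewEval τ c (n + 1)).ker
          = Nat.card D.ker * Nat.card ↥(D.range ⊓ (skewEval τ d n).ker) := by
            rw [hker, card_addMonoidHom_ker_comp]
        _ ≤ Nat.card D.ker * Nat.card (skewEval τ d n).ker :=
            Nat.mul_le_mul_left _ (AddSubgroup.card_le_of_le inf_le_right)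
        _ ≤ Nat.card {x : K // τ x = x} * Nat.card {x : K // τ x = x} ^ n :=
            Nat.mul_le_mul hfix.le (ih (exists_sum_range_ne_zero hz0 hz hc))
        _ = Nat.card {x : K // τ x = x} ^ (n + 1) := (pow_succ' _ _).symm

end SkewPolynomial

section TwistedForm

variable {F K : Type*} [Field F] [Field K] [Algebra F K] (σ : K ≃ₐ[F] K) (a : K × K)

/-- The quadratic form `x ↦ Tr(a x σ(x) + b x σ³(x))` attached to the pair `(a, b)`; its values are
the coordinates of the codewords. -/
def twistedForm (x : K) : F :=
  Algebra.trace F K (a.1 * (x * σ x) + a.2 * (x * σ (σ (σ x))))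

/-- The operator representing the polar form of `twistedForm σ a` with respect to the trace
pairing. -/
def polarOp : K →+ K where
  toFun z := a.1 * σ z + σ.symm (a.1 * z) + a.2 * σ (σ (σ z))
    + σ.symm (σ.symm (σ.symm (a.2 * z)))
  map_zero' := by simp
  map_add' x y := by simp only [mul_add, map_add]; ring

theorem polarOp_apply (z : K) : polarOp σ a z = a.1 * σ z + σ.symm (a.1 * z) + a.2 * σ (σ (σ z))
    + σ.symm (σ.symm (σ.symm (a.2 * z))) := rfl

theorem trace_mul_symm_apply (τ : K ≃ₐ[F] K) (y z : K) :
    Algebra.trace F K (y * τ.symm z) = Algebra.trace F K (z * τ y) := by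
  rw [← Algebra.trace_eq_of_algEquiv τ (y * τ.symm z), map_mul, τ.apply_symm_apply, mul_comm]

theorem polar_twistedForm (y z : K) :
    QuadraticMap.polar (twistedForm σ a) y z = Algebra.trace F K (y * polarOp σ a z) := by
  have h₁ := trace_mul_symm_apply σ y (a.1 * z)
  have h₃ := trace_mul_symm_apply (σ * σ * σ) y (a.2 * z)
  change Algebra.trace F K (y * σ.symm (σ.symm (σ.symm (a.2 * z))))
    = Algebra.trace F K (a.2 * z * σ (σ (σ y))) at h₃
  simp only [QuadraticMap.polar, twistedForm, polarOp_apply, mul_add, map_add, h₁, h₃, add_mul,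
    mul_left_comm y, mul_assoc]
  ring

theorem twistedForm_zero : twistedForm σ a 0 = 0 := by
  simp [twistedForm]

theorem twistedForm_neg (x : K) : twistedForm σ a (-x) = twistedForm σ a x := by
  simp [twistedForm]

theorem twistedForm_eq_zero_of_polarOp_eq_zero (hF : (2 : F) ≠ 0) {z : K}
    (hz : polarOp σ a z = 0) : twistedForm σ a z = 0 := by
  have h := polar_twistedForm σ a (-z) z
  rw [QuadraticMap.polar, hz, mul_zero, map_zero, neg_add_cancel, twistedForm_zero, twistedForm_neg,
    zero_sub, neg_sub_left, neg_eq_zero, ← two_mul] at h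
  exact (mul_eq_zero.1 h).resolve_left hF

variable {σ}

theorem twistedForm_mul {u : K} {c : F} (hc : c ≠ 0) (hu : u * σ u = algebraMap F K c) (x : K) :
    twistedForm σ a (u * x) = c * twistedForm σ a x := by
  have h := sq_apply_eq_of_mul_apply_eq (σ.commutes c) (by simpa using hc) hu
  rw [twistedForm, twistedForm, ← smul_eq_mul c, ← map_smul, Algebra.smul_def, ← hu]
  congr 1
  simp only [map_mul, h]
  ring

theorem twistedForm_mul_of_norm_one {u : K} (hu : u * σ u = 1) (x : K) :
    twistedForm σ a (u * x) = twistedForm σ a x := by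
  rw [twistedForm_mul a one_ne_zero (by rw [hu, map_one]), one_mul]

end TwistedForm

theorem exists_isPrimitive_comp_trace (F K : Type*) [Field F] [Field K] [Algebra F K] [Finite K] :
    ∃ ψ : AddChar F ℂ, ψ ≠ 1 ∧
      (ψ.compAddMonoidHom (Algebra.trace F K).toAddMonoidHom).IsPrimitive := by
  have := Finite.of_injective _ (algebraMap F K).injective
  obtain ⟨ψ, hψ⟩ := AddChar.exists_apply_ne_zero.2 (one_ne_zero (α := F))
  obtain ⟨x, hx⟩ := Algebra.trace_surjective F K 1
  exact ⟨ψ, AddChar.ne_one_iff.2 ⟨1, hψ⟩,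
    AddChar.IsPrimitive.of_ne_one (AddChar.ne_one_iff.2 ⟨x, by simpa [hx] using hψ⟩)⟩

theorem sum_addChar_inv_mul_sum_addChar {F K : Type*} [Field F] [Field K] [Fintype K] [Algebra F K]
    (σ : K ≃ₐ[F] K) (a : K × K) (hF : (2 : F) ≠ 0) {ψ : AddChar F ℂ}
    (hψ : (ψ.compAddMonoidHom (Algebra.trace F K).toAddMonoidHom).IsPrimitive) :
    (∑ y, ψ⁻¹ (twistedForm σ a y)) * ∑ x, ψ (twistedForm σ a x) =
      Fintype.card K * Nat.card (polarOp σ a).ker := by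
  classical
  set χ := ψ.compAddMonoidHom (Algebra.trace F K).toAddMonoidHom
  have hpolar (y z : K) : ψ (-twistedForm σ a y) * ψ (twistedForm σ a (y + z)) =
      ψ (twistedForm σ a z) * χ (y * polarOp σ a z) := by
    change _ = ψ _ * ψ (Algebra.trace F K (y * polarOp σ a z))
    rw [← AddChar.map_add_eq_mul, ← AddChar.map_add_eq_mul, ← polar_twistedForm,
      QuadraticMap.polar]
    congr 1
    ring
  calc (∑ y, ψ⁻¹ (twistedForm σ a y)) * ∑ x, ψ (twistedForm σ a x)
      = ∑ y, ∑ z, ψ (-twistedForm σ a y) * ψ (twistedForm σ a (y + z)) := by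
        rw [sum_mul]
        refine sum_congr rfl fun y _ => ?_
        rw [AddChar.inv_apply, ← mul_sum, ← Equiv.sum_comp (Equiv.addLeft y)]
        rfl
    _ = ∑ z, ψ (twistedForm σ a z) * ∑ y, χ (y * polarOp σ a z) := by
        simp only [hpolar, mul_sum]
        exact sum_comm
    _ = ∑ z, if polarOp σ a z = 0 then (Fintype.card K : ℂ) else 0 := by
        refine sum_congr rfl fun z _ => ?_
        rw [AddChar.sum_mulShift _ hψ]
        split_ifs with hz
        · simp [twistedForm_eq_zero_of_polarOp_eq_zero σ a hF hz]
        · simp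
    _ = Fintype.card K * Nat.card (polarOp σ a).ker := by
        rw [← sum_filter, sum_const, nsmul_eq_mul, mul_comm,
          ← Nat.subtype_card _ fun z => mem_filter_univ z]
        rfl

section Excess

variable {F K : Type*} [Field F] [DecidableEq F] [Field K] [Fintype K] [Algebra F K]

/-- The number of zeros of the form `twistedForm σ a` minus the number of points where it
takes the value `1`. It equals the character sum `∑ x, ψ (twistedForm σ a x)` for every nontrivial
additive character `ψ` of `F`. -/
def excess (σ : K ≃ₐ[F] K) (a : K × K) : ℤ :=
  #{x : K | twistedForm σ a x = 0} - #{x : K | twistedForm σ a x = 1}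

variable [DecidableEq K] {σ : K ≃ₐ[F] K} {Q : ℕ} (a : K × K)

theorem NormRegular.card_twistedForm_eq (h : NormRegular σ Q) {c : F} (hc : c ≠ 0) :
    #{x : K | twistedForm σ a x = c} = #{x : K | twistedForm σ a x = 1} := by
  obtain ⟨u, hu⟩ : ∃ u : K, u * σ u = algebraMap F K c := by
    have hpos : 0 < #{u : K | u * σ u = algebraMap F K c} := by
      rw [h _ (σ.commutes c) (by simpa using hc)]
      exact Q.succ_pos
    simpa [Finset.Nonempty] using card_pos.1 hpos
  have hu0 : u ≠ 0 := left_ne_zero_of_mul (hu.trans_ne (by simpa using hc))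
  refine (card_equiv (Equiv.mulLeft₀ u hu0) fun x => ?_).symm
  simp only [mem_filter_univ, Equiv.mulLeft₀_apply, twistedForm_mul a hc hu, mul_eq_left₀ hc]

theorem NormRegular.sum_comp_twistedForm [Fintype F] (h : NormRegular σ Q) {M : Type*} [CommRing M]
    (g : F → M) : ∑ x, g (twistedForm σ a x) =
      excess σ a * g 0 + #{x : K | twistedForm σ a x = 1} * ∑ c, g c := by
  have hlevel : ∀ c ∈ univ.erase (0 : F), (#{x : K | twistedForm σ a x = c} : M) * g c =
      #{x : K | twistedForm σ a x = 1} * g c := fun c hc => by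
    rw [h.card_twistedForm_eq a (ne_of_mem_erase hc)]
  rw [← sum_fiberwise' univ (twistedForm σ a)]
  simp only [sum_const, nsmul_eq_mul]
  rw [← add_sum_erase _ _ (mem_univ 0), sum_congr rfl hlevel, ← mul_sum,
    ← add_sum_erase _ g (mem_univ 0), excess]
  push_cast
  ring

theorem NormRegular.excess_add_card [Fintype F] (h : NormRegular σ Q) :
    excess σ a + #{x : K | twistedForm σ a x = 1} * Fintype.card F = Fintype.card K := by
  simpa using (h.sum_comp_twistedForm (M := ℤ) a (fun _ => 1)).symm

theorem NormRegular.sum_addChar_twistedForm (h : NormRegular σ Q) {ψ : AddChar F ℂ} (hψ : ψ ≠ 1) :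
    ∑ x, ψ (twistedForm σ a x) = excess σ a := by
  have := Fintype.ofInjective _ (algebraMap F K).injective
  rw [h.sum_comp_twistedForm a ψ, AddChar.sum_eq_zero_of_ne_one hψ, AddChar.map_zero_eq_one,
    mul_one, mul_zero, add_zero]

theorem NormRegular.excess_sq (h : NormRegular σ Q) (hF : (2 : F) ≠ 0) :
    excess σ a ^ 2 = Fintype.card K * Nat.card (polarOp σ a).ker := by
  obtain ⟨ψ, hψ, hprim⟩ := exists_isPrimitive_comp_trace F K
  have hsq := sum_addChar_inv_mul_sum_addChar σ a hF hprim
  rw [h.sum_addChar_twistedForm a hψ, h.sum_addChar_twistedForm a (inv_ne_one.2 hψ), ← sq] at hsq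
  exact_mod_cast hsq

end Excess

section PolarKernel

variable {F K : Type*} [Field F] [Field K] [Algebra F K] (σ : K ≃ₐ[F] K) (a : K × K)

theorem polarOp_mul {e : K} (he : σ (σ e) = e) (z : K) :
    polarOp σ a (e * z) = σ e * polarOp σ a z := by
  have h1 : σ.symm e = σ e := by rw [AlgEquiv.symm_apply_eq, he]
  have h2 : σ.symm (σ e) = e := σ.symm_apply_apply e
  simp only [polarOp_apply, map_mul, h1, h2, he]
  ring

/-- The kernel of the polar operator, as a subspace over the fixed field of `σ²`. -/
def polarKer : Submodule (((σ ^ 2 : K ≃ₐ[F] K) : K →+* K).eqLocusField (RingHom.id K)) K :=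
  { (polarOp σ a).ker with
    smul_mem' := fun e z (hz : polarOp σ a z = 0) => by
      change polarOp σ a (e * z) = 0
      rw [polarOp_mul σ a (show σ (σ (e : K)) = e from e.2), hz, mul_zero] }

/-- The coefficients of `σ³ ∘ polarOp σ a` as a polynomial in `σ²`. -/
def polarCoeff : ℕ → K
  | 0 => a.2
  | 1 => σ (σ a.1)
  | 2 => σ (σ (σ a.1))
  | _ => σ (σ (σ a.2))

theorem skewEval_polarCoeff (z : K) :
    skewEval ((σ ^ 2 : K ≃ₐ[F] K) : K →+* K) (polarCoeff σ a) 3 z =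
      σ (σ (σ (polarOp σ a z))) := by
  simp only [skewEval_apply, sum_range_succ, polarCoeff, polarOp_apply, map_add, map_mul,
    AlgEquiv.apply_symm_apply]
  simp [pow_two]
  ring

variable {σ a} in
theorem exists_polarCoeff_ne_zero (ha : a ≠ 0) : ∃ i ≤ 3, polarCoeff σ a i ≠ 0 := by
  by_contra! h
  have h₁ : a.1 = 0 := by simpa [polarCoeff] using h 1 (by norm_num)
  exact ha (Prod.ext h₁ (h 0 (by norm_num)))

variable {σ a} [Fintype K] [DecidableEq K] {Q : ℕ}

theorem exists_card_ker_polarOp (hQ : 1 < Q) (hE : #{x : K | σ (σ x) = x} = Q ^ 2) (ha : a ≠ 0) :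
    ∃ d < 4, Nat.card (polarOp σ a).ker = Q ^ (2 * d) := by
  have hE' : Nat.card {x : K // (σ ^ 2) x = x} = Q ^ 2 := by
    rw [← hE]
    exact Nat.subtype_card _ fun x => mem_filter_univ x
  have hdim : Nat.card (polarOp σ a).ker = (Q ^ 2) ^ _ :=
    hE' ▸ Module.natCard_eq_pow_finrank
      (K := ((σ ^ 2 : K ≃ₐ[F] K) : K →+* K).eqLocusField (RingHom.id K)) (V := polarKer σ a)
  have hker : Nat.card (polarOp σ a).ker =
      Nat.card (skewEval ((σ ^ 2 : K ≃ₐ[F] K) : K →+* K) (polarCoeff σ a) 3).ker :=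
    Nat.card_congr (Equiv.subtypeEquivRight fun z => by
      simp [AddMonoidHom.mem_ker, skewEval_polarCoeff])
  have hle : Nat.card (polarOp σ a).ker ≤ (Q ^ 2) ^ 3 :=
    hE' ▸ hker ▸ card_ker_skewEval_le (exists_polarCoeff_ne_zero ha)
  rw [hdim, Nat.pow_le_pow_iff_right (Nat.one_lt_pow two_ne_zero hQ)] at hle
  exact ⟨_, Nat.lt_succ_of_le hle, by rw [hdim, pow_mul]⟩

end PolarKernel

section Sign

variable {F K : Type*} [Field F] [Field K] [Fintype K] [DecidableEq K] [Algebra F K]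
  {σ : K ≃ₐ[F] K} {Q N : ℕ}

theorem NormRegular.dvd_card (h : NormRegular σ Q) {s : Finset K} (h0 : 0 ∉ s)
    (hs : ∀ u x : K, u * σ u = 1 → x ∈ s → u * x ∈ s) : Q + 1 ∣ #s := by
  rw [card_eq_sum_card_image (fun x => x * σ x) s]
  refine dvd_sum fun b hb => ?_
  obtain ⟨y, hy, rfl⟩ := mem_image.1 hb
  have hy0 : y ≠ 0 := ne_of_mem_of_not_mem hy h0
  have hnorm (u : K) : u * y * σ (u * y) = y * σ y ↔ u * σ u = 1 := by
    rw [map_mul, mul_mul_mul_comm, mul_eq_right₀ (by simpa using hy0)]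
  rw [← h 1 (map_one σ) one_ne_zero]
  refine (card_equiv (Equiv.mulRight₀ y hy0) fun u => ?_).dvd
  simp only [mem_filter, mem_univ, true_and, Equiv.mulRight₀_apply, hnorm]
  exact ⟨fun hu => ⟨hs u y hu hy, hu⟩, And.right⟩

variable [DecidableEq F] (a : K × K)

theorem NormRegular.excess_modEq_one (h : NormRegular σ Q) : excess σ a ≡ 1 [ZMOD Q + 1] := by
  have hone : Q + 1 ∣ #{x : K | twistedForm σ a x = 1} :=
    h.dvd_card (by simp [twistedForm_zero]) fun u x hu hx => by
      simpa [twistedForm_mul_of_norm_one a hu] using hx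
  have hzero : Q + 1 ∣ #((univ.filter fun x => twistedForm σ a x = 0).erase 0) :=
    h.dvd_card (by simp) fun u x hu hx => by
      have hu0 : u ≠ 0 := left_ne_zero_of_mul (hu.trans_ne one_ne_zero)
      simpa [twistedForm_mul_of_norm_one a hu, hu0] using hx
  rw [excess, ← card_erase_add_one (a := (0 : K)) (by simp [twistedForm_zero])]
  zify at hone hzero
  simpa using ((Int.modEq_zero_iff_dvd.2 hzero).add_right 1).sub (Int.modEq_zero_iff_dvd.2 hone)

theorem eq_neg_pow_of_sq_eq {Q S : ℤ} (hQ : 1 < Q) {n : ℕ} (hS : S ^ 2 = (Q ^ n) ^ 2)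
    (hmod : S ≡ 1 [ZMOD Q + 1]) : S = (-Q) ^ n := by
  have hpow : (-Q) ^ n ≡ 1 [ZMOD Q + 1] := by
    simpa using (Int.modEq_iff_dvd.2 (by simp [add_comm]) : -Q ≡ 1 [ZMOD Q + 1]).pow n
  have hsq : S ^ 2 = ((-Q) ^ n) ^ 2 := by rw [hS, ← pow_mul', ← pow_mul', pow_mul, pow_mul, neg_sq]
  refine (sq_eq_sq_iff_eq_or_eq_neg.1 hsq).resolve_right fun hneg => ?_
  have htwo : Q + 1 ∣ 2 := by
    simpa [hneg, one_add_one_eq_two] using (hmod.add hpow).dvd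
  linarith [Int.le_of_dvd two_pos htwo]

theorem NormRegular.exists_excess_eq (h : NormRegular σ Q) (hF : (2 : F) ≠ 0)
    (hQ : 1 < Q) (hE : #{x : K | σ (σ x) = x} = Q ^ 2) (hK : Fintype.card K = Q ^ (2 * N))
    {a : K × K} (ha : a ≠ 0) : ∃ i : Fin 4, excess σ a = (-(Q : ℤ)) ^ (N + i) := by
  obtain ⟨d, hd, hker⟩ := exists_card_ker_polarOp hQ hE ha
  refine ⟨⟨d, hd⟩, eq_neg_pow_of_sq_eq (by exact_mod_cast hQ) ?_ (h.excess_modEq_one a)⟩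
  rw [h.excess_sq a hF, hker, hK]
  push_cast
  ring

end Sign

theorem sq_apply_eq_of_isotropic {F K : Type*} [Field F] [Field K] [Algebra F K]
    {σ : K ≃ₐ[F] K} {t s : K} (h₁ : 1 + (t * σ t + s * σ s) = 0)
    (h₃ : 1 + (t * σ (σ (σ t)) + s * σ (σ (σ s))) = 0) : σ (σ t) = t ∧ σ (σ s) = s := by
  have e₁ : 1 + (σ t * σ (σ t) + σ s * σ (σ s)) = 0 := by simpa using congrArg σ h₁
  have e₂ : 1 + (σ (σ t) * σ (σ (σ t)) + σ (σ s) * σ (σ (σ s))) = 0 := by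
    simpa using congrArg σ e₁
  -- The defect `(σ²t - t, σ²s - s)` is orthogonal to `(σt, σs)` and to `(σ³t, σ³s)`.
  have r₁ : (σ (σ t) - t) * σ t + (σ (σ s) - s) * σ s = 0 := by linear_combination e₁ - h₁
  have r₃ : (σ (σ t) - t) * σ (σ (σ t)) + (σ (σ s) - s) * σ (σ (σ s)) = 0 := by
    linear_combination e₂ - h₃
  by_cases hdet : σ t * σ (σ (σ s)) - σ (σ (σ t)) * σ s = 0
  · have hdet' : t * σ (σ s) - σ (σ t) * s = 0 := σ.injective (by simpa using hdet)
    constructor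
    · linear_combination -t * r₁ + (σ (σ t) - t) * h₁ + σ s * hdet'
    · linear_combination -s * r₁ + (σ (σ s) - s) * h₁ - σ t * hdet'
  · constructor
    · refine sub_eq_zero.1 ((mul_eq_zero.1 ?_).resolve_right hdet)
      linear_combination σ (σ (σ s)) * r₁ - σ s * r₃
    · refine sub_eq_zero.1 ((mul_eq_zero.1 ?_).resolve_right hdet)
      linear_combination σ t * r₃ - σ (σ (σ t)) * r₁

theorem affineIsotropic_iff {F K : Type*} [Field F] [Field K] [Algebra F K] {σ : K ≃ₐ[F] K}
    {t s : K} :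
    (1 + (t * σ t + s * σ s) = 0 ∧ 1 + (t * σ (σ (σ t)) + s * σ (σ (σ s))) = 0) ↔
      σ (σ t) = t ∧ s * σ s = -(1 + t * σ t) ∧ σ (σ s) = s := by
  constructor
  · rintro ⟨h₁, h₃⟩
    obtain ⟨ht, hs⟩ := sq_apply_eq_of_isotropic h₁ h₃
    exact ⟨ht, by linear_combination h₁, hs⟩
  · rintro ⟨ht, h₁, hs⟩
    rw [ht, hs]
    constructor <;> linear_combination h₁

section Isotropic

variable {F K : Type*} [Field F] [Field K] [Fintype K] [DecidableEq K] [Algebra F K]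
  (σ : K ≃ₐ[F] K) (k : ℕ)

/-- The vectors of `Kᵏ` orthogonal to their images under `σ` and under `σ³`. -/
def isotropicVectors : Finset (Fin k → K) :=
  {v | ∑ i, v i * σ (v i) = 0 ∧ ∑ i, v i * σ (σ (σ (v i))) = 0}

/-- The vectors `v` of `Kᵏ` for which `(1, v)` is isotropic; for `k = 2` these are affine points
of a Hermitian curve. -/
def affineIsotropicVectors : Finset (Fin k → K) :=
  {v | 1 + ∑ i, v i * σ (v i) = 0 ∧ 1 + ∑ i, v i * σ (σ (σ (v i))) = 0}

variable {k} in
theorem smul_mem_isotropicVectors {v : Fin k → K} (hv : v ∈ isotropicVectors σ k) (c : K) :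
    c • v ∈ isotropicVectors σ k := by
  have hsum (d : K) (w : Fin k → K) : ∑ i, c * v i * (d * w i) = c * d * ∑ i, v i * w i := by
    rw [mul_sum]
    exact sum_congr rfl fun i _ => mul_mul_mul_comm ..
  rw [isotropicVectors, mem_filter_univ] at hv ⊢
  simp only [Pi.smul_apply, smul_eq_mul, map_mul, hsum, hv, mul_zero, and_self]

theorem card_isotropicVectors_succ :
    #(isotropicVectors σ (k + 1)) =
      #(isotropicVectors σ k) + (Fintype.card K - 1) * #(affineIsotropicVectors σ k) := by
  have hfiber (z : K) (hz : z ≠ 0) :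
      #{w : Fin k → K | Fin.cons z w ∈ isotropicVectors σ (k + 1)} =
        #(affineIsotropicVectors σ k) := by
    have hmem (w : Fin k → K) :
        w ∈ affineIsotropicVectors σ k ↔ Fin.cons 1 w ∈ isotropicVectors σ (k + 1) := by
      simp [affineIsotropicVectors, isotropicVectors, Fin.sum_univ_succ]
    have hcons (w : Fin k → K) : z • (Fin.cons 1 w : Fin (k + 1) → K) = Fin.cons z (z • w) := by
      ext i
      refine Fin.cases ?_ (fun i => ?_) i <;> simp
    refine (card_equiv (Equiv.smulRight hz) fun w => ?_).symm
    rw [hmem, mem_filter_univ, Equiv.smulRight_apply, ← hcons]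
    refine ⟨fun h => smul_mem_isotropicVectors σ h z, fun h => ?_⟩
    simpa [smul_smul, hz] using smul_mem_isotropicVectors σ h z⁻¹
  have hzero : #{w : Fin k → K | Fin.cons 0 w ∈ isotropicVectors σ (k + 1)} =
      #(isotropicVectors σ k) := by
    simp [isotropicVectors, Fin.sum_univ_succ]
  calc #(isotropicVectors σ (k + 1))
      = ∑ z : K, #{w : Fin k → K | Fin.cons z w ∈ isotropicVectors σ (k + 1)} := by
        simp only [card_filter]
        rw [← Fintype.sum_prod_type' fun z w => if Fin.cons z w ∈ isotropicVectors σ (k + 1)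
            then 1 else 0, ← filter_univ_mem (isotropicVectors σ (k + 1)), card_filter,
          ← Equiv.sum_comp (Fin.consEquiv fun _ => K)]
        simp only [mem_filter_univ]
        rfl
    _ = _ := by
        rw [← add_sum_erase _ _ (mem_univ 0), hzero,
          sum_congr rfl fun z hz => hfiber z (ne_of_mem_erase hz), sum_const,
          card_erase_of_mem (mem_univ _), card_univ, smul_eq_mul]

theorem card_isotropicVectors_one : #(isotropicVectors σ 1) = 1 := by
  rw [card_isotropicVectors_succ]
  simp [isotropicVectors, affineIsotropicVectors]

variable {σ} {Q : ℕ}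

theorem NormRegular.card_affineIsotropicVectors_one (h : NormRegular σ Q) :
    #(affineIsotropicVectors σ 1) = Q + 1 := by
  rw [← h (-1) (by simp) (by simp)]
  refine card_equiv (Equiv.funUnique (Fin 1) K) fun v => ?_
  simp only [affineIsotropicVectors, Fin.sum_univ_one, mem_filter_univ, Equiv.funUnique_apply,
    Fin.default_eq_zero, eq_neg_iff_add_eq_zero, add_comm (1 : K)]
  refine and_iff_left_of_imp fun hv => ?_
  rw [sq_apply_eq_of_mul_apply_eq (c := -1) (by simp) (by simp) (eq_neg_of_add_eq_zero_left hv), hv]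

theorem NormRegular.card_isotropicVectors_two (h : NormRegular σ Q) :
    #(isotropicVectors σ 2) = 1 + (Fintype.card K - 1) * (Q + 1) := by
  rw [card_isotropicVectors_succ, card_isotropicVectors_one, h.card_affineIsotropicVectors_one]

theorem NormRegular.card_affineIsotropicVectors_fiber (h : NormRegular σ Q) (t : K) :
    #{s : K | 1 + (t * σ t + s * σ s) = 0 ∧ 1 + (t * σ (σ (σ t)) + s * σ (σ (σ s))) = 0} =
      if σ (σ t) = t then if t * σ t = -1 then 1 else Q + 1 else 0 := by
  simp only [affineIsotropic_iff]
  split_ifs with ht h0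
  · have hzero : ∀ s : K, s = 0 → σ (σ s) = s := by simp
    simp [ht, h0, and_iff_left_of_imp (hzero _), filter_eq']
  · have hne : -(1 + t * σ t) ≠ 0 := by
      rwa [neg_ne_zero, add_comm, Ne, ← eq_neg_iff_add_eq_zero]
    have hfix : σ (-(1 + t * σ t)) = -(1 + t * σ t) := by simp [ht, mul_comm]
    simp only [ht, true_and]
    rw [← h _ hfix hne]
    congr 1
    ext s
    simpa using sq_apply_eq_of_mul_apply_eq hfix hne
  · simp [ht]

theorem NormRegular.card_affineIsotropicVectors_two (h : NormRegular σ Q)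
    (hE : #{x : K | σ (σ x) = x} = Q ^ 2) : #(affineIsotropicVectors σ 2) + Q = Q ^ 3 := by
  have hsum : #(affineIsotropicVectors σ 2) =
      ∑ t : K, if σ (σ t) = t then if t * σ t = -1 then 1 else Q + 1 else 0 := by
    simp only [← h.card_affineIsotropicVectors_fiber, affineIsotropicVectors, Fin.sum_univ_two,
      card_filter]
    rw [← Equiv.sum_comp (finTwoArrowEquiv K).symm, Fintype.sum_prod_type]
    rfl
  have hone : #{t : K | σ (σ t) = t ∧ t * σ t = -1} = Q + 1 := by
    rw [← h (-1) (by simp) (by simp)]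
    congr 1
    ext t
    simpa using sq_apply_eq_of_mul_apply_eq (by simp) (by simp)
  have hsplit : #{t : K | σ (σ t) = t ∧ t * σ t = -1} + #{t : K | σ (σ t) = t ∧ t * σ t ≠ -1}
      = Q ^ 2 := by
    rw [← hE, ← filter_filter, ← filter_filter]
    exact card_filter_add_card_filter_not _
  rw [hone] at hsplit
  rw [hsum, ← sum_filter, sum_ite, filter_filter, filter_filter, sum_const, sum_const, hone,
    smul_eq_mul, smul_eq_mul]
  zify at hsplit ⊢
  linear_combination ((Q : ℤ) + 1) * hsplit

theorem NormRegular.card_isotropicVectors_three (h : NormRegular σ Q)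
    (hE : #{x : K | σ (σ x) = x} = Q ^ 2) :
    #(isotropicVectors σ 3) = 1 + (Fintype.card K - 1) * (Q ^ 3 + 1) := by
  rw [card_isotropicVectors_succ, h.card_isotropicVectors_two,
    ← h.card_affineIsotropicVectors_two hE]
  ring

end Isotropic

theorem addChar_map_sum {ι A M : Type*} [AddCommMonoid A] [CommMonoid M] (χ : AddChar A M)
    (s : Finset ι) (f : ι → A) : χ (∑ i ∈ s, f i) = ∏ i ∈ s, χ (f i) :=
  map_prod χ.toMonoidHom (fun i => Multiplicative.ofAdd (f i)) s

section Moments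

variable {F K : Type*} [Field F] [DecidableEq F] [Field K] [Fintype K] [DecidableEq K]
  [Algebra F K] {σ : K ≃ₐ[F] K} {Q : ℕ}

theorem NormRegular.sum_excess_pow (h : NormRegular σ Q) (k : ℕ) :
    ∑ a, excess σ a ^ k = (Fintype.card K : ℤ) ^ 2 * #(isotropicVectors σ k) := by
  obtain ⟨ψ, hψ, hprim⟩ := exists_isPrimitive_comp_trace F K
  set χ := ψ.compAddMonoidHom (Algebra.trace F K).toAddMonoidHom
  have hpow (a : K × K) : (excess σ a : ℂ) ^ k = ∑ v : Fin k → K,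
      χ (a.1 * ∑ i, v i * σ (v i)) * χ (a.2 * ∑ i, v i * σ (σ (σ (v i)))) := by
    rw [← h.sum_addChar_twistedForm a hψ, Fintype.sum_pow]
    refine sum_congr rfl fun v _ => ?_
    rw [← AddChar.map_add_eq_mul, mul_sum, mul_sum, ← sum_add_distrib, addChar_map_sum]
    rfl
  suffices (∑ a, excess σ a ^ k : ℂ) = (Fintype.card K : ℂ) ^ 2 * #(isotropicVectors σ k) by
    exact_mod_cast this
  simp only [hpow, isotropicVectors, card_filter, Nat.cast_sum, mul_sum]
  rw [sum_comm]
  refine sum_congr rfl fun v _ => ?_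
  simp only [Fintype.sum_prod_type, ← mul_sum, ← sum_mul, AddChar.sum_mulShift _ hprim, ite_and]
  split_ifs <;> simp [sq]

theorem NormRegular.sum_excess (h : NormRegular σ Q) :
    ∑ a, excess σ a = (Fintype.card K : ℤ) ^ 2 := by
  simpa [card_isotropicVectors_one] using h.sum_excess_pow 1

theorem NormRegular.sum_excess_sq (h : NormRegular σ Q) :
    ∑ a, excess σ a ^ 2 =
      (Fintype.card K : ℤ) ^ 2 * (1 + ((Fintype.card K : ℤ) - 1) * (Q + 1)) := by
  rw [h.sum_excess_pow, h.card_isotropicVectors_two]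
  push_cast [Nat.cast_sub (Fintype.card_pos (α := K))]
  rfl

theorem NormRegular.sum_excess_cube (h : NormRegular σ Q)
    (hE : #{x : K | σ (σ x) = x} = Q ^ 2) :
    ∑ a, excess σ a ^ 3 =
      (Fintype.card K : ℤ) ^ 2 * (1 + ((Fintype.card K : ℤ) - 1) * (Q ^ 3 + 1)) := by
  rw [h.sum_excess_pow, h.card_isotropicVectors_three hE]
  push_cast [Nat.cast_sub (Fintype.card_pos (α := K))]
  rfl

end Moments

section Frequencies

/-- The solution of the linear system `∑ i, fᵢ (-Q)ⁱᵏ = (T² - 1) cₖ` for `k = 0, 1, 2, 3`, with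
`c = (T² + 1, T, (Q + 1)T², Q³T)`, up to the common denominator `(Q + 1)(Q² - 1)(Q³ + 1)`. -/
def momentSolution {𝕜 : Type*} [Field 𝕜] (Q T : 𝕜) (i : Fin 4) : 𝕜 :=
  (T ^ 2 - 1) *
    ![Q ^ 6 * (T ^ 2 + 1) - (Q ^ 4 + Q) * T ^ 2 + (Q ^ 5 - Q ^ 4) * T,
      (Q ^ 2 - Q + 1) *
        (Q ^ 5 * (T ^ 2 + 1) + (Q ^ 3 - Q ^ 2 - 1) * (Q + 1) * T ^ 2 - (Q ^ 5 - Q ^ 2) * T) / Q ^ 2,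
      (Q ^ 2 - Q + 1) *
        ((Q ^ 3 + Q - 1) * (Q + 1) * T ^ 2 - Q ^ 4 * (T ^ 2 + 1) + (Q ^ 4 - Q) * T) / Q ^ 3,
      (T ^ 2 - Q ^ 3 - (Q ^ 2 - Q) * T) / Q ^ 3] i

theorem eq_momentSolution {𝕜 : Type*} [Field 𝕜] {Q T : 𝕜} (hQ : Q ≠ 0) {f : Fin 4 → 𝕜}
    (h₀ : ∑ i, f i = (T ^ 2 - 1) * (T ^ 2 + 1))
    (h₁ : ∑ i : Fin 4, f i * (-Q) ^ (i : ℕ) = (T ^ 2 - 1) * T)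
    (h₂ : ∑ i : Fin 4, f i * ((-Q) ^ (i : ℕ)) ^ 2 = (T ^ 2 - 1) * ((Q + 1) * T ^ 2))
    (h₃ : ∑ i : Fin 4, f i * ((-Q) ^ (i : ℕ)) ^ 3 = (T ^ 2 - 1) * (Q ^ 3 * T)) (i : Fin 4) :
    (Q + 1) * (Q ^ 2 - 1) * (Q ^ 3 + 1) * f i = momentSolution Q T i := by
  simp only [Fin.sum_univ_four, Fin.coe_ofNat_eq_mod, Nat.reduceMod] at h₀ h₁ h₂ h₃
  -- The coefficients on the right are those of `∏ j ≠ i, (X - (-Q) ^ j)`.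
  fin_cases i <;>
    simp only [momentSolution, Fin.zero_eta, Fin.mk_one, Fin.reduceFinMk, Matrix.cons_val] <;>
    field_simp
  · linear_combination -(h₃ - (-Q + Q ^ 2 - Q ^ 3) * h₂ + (-Q ^ 3 + Q ^ 4 - Q ^ 5) * h₁
      - Q ^ 6 * h₀)
  · linear_combination (Q ^ 2 - Q + 1) * (h₃ - (1 + Q ^ 2 - Q ^ 3) * h₂
      + (Q ^ 2 - Q ^ 3 - Q ^ 5) * h₁ + Q ^ 5 * h₀)
  · linear_combination (Q ^ 2 - Q + 1) * (h₃ - (1 - Q - Q ^ 3) * h₂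
      + (-Q - Q ^ 3 + Q ^ 4) * h₁ - Q ^ 4 * h₀)
  · linear_combination -(h₃ - (1 - Q + Q ^ 2) * h₂ + (-Q + Q ^ 2 - Q ^ 3) * h₁ + Q ^ 3 * h₀)

theorem freqDen_eq (p δ : ℕ) :
    freqDen p δ = ((p : ℚ) ^ δ + 1) * (((p : ℚ) ^ δ) ^ 2 - 1) * (((p : ℚ) ^ δ) ^ 3 + 1) := by
  rw [freqDen]
  ring

theorem freqDen_ne_zero {p δ : ℕ} (hQ : 1 < p ^ δ) : freqDen p δ ≠ 0 := by
  have hQ' : (1 : ℚ) < (p : ℚ) ^ δ := by exact_mod_cast hQ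
  have hsq : 0 < ((p : ℚ) ^ δ) ^ 2 - 1 := sub_pos.2 (one_lt_pow₀ hQ' two_ne_zero)
  rw [freqDen_eq]
  positivity

theorem freqNum_eq_momentSolution {p m δ : ℕ} (hp : p ≠ 0) (hm : Even m) (hδ : 2 * δ ≤ m / 2)
    {ε : ℚ} (hε : ε ^ 2 = 1) (i : Fin 4) :
    freqNum p m δ ε i = momentSolution ((p : ℚ) ^ δ) (ε * (p : ℚ) ^ (m / 2)) i := by
  have hp' : (p : ℚ) ≠ 0 := Nat.cast_ne_zero.2 hp
  obtain ⟨M, rfl⟩ := hm.two_dvd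
  rw [Nat.mul_div_cancel_left M two_pos] at hδ ⊢
  have hT : (ε * (p : ℚ) ^ M) ^ 2 = ((p : ℚ) ^ M) ^ 2 := by rw [mul_pow, hε, one_mul]
  fin_cases i <;>
    simp only [freqNum, momentSolution, hT, altSum, sum_range_succ, range_zero, sum_empty,
      Fin.zero_eta, Fin.mk_one, Fin.reduceFinMk, Matrix.cons_val, Nat.mul_div_cancel_left M two_pos,
      pow_sub₀ (p : ℚ) hp' (show 2 * δ ≤ 2 * (2 * M) by lia),
      pow_sub₀ (p : ℚ) hp' (show 3 * δ ≤ 2 * (2 * M) by lia),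
      pow_sub₀ (p : ℚ) hp' (show 2 * δ ≤ 2 * M by lia),
      pow_sub₀ (p : ℚ) hp' (show 3 * δ ≤ 2 * M by lia),
      pow_sub₀ (p : ℚ) hp' (show 2 * δ ≤ 3 * M by lia),
      pow_sub₀ (p : ℚ) hp' (show δ ≤ 3 * M by lia),
      pow_sub₀ (p : ℚ) hp' (show 2 * δ ≤ M by lia),
      pow_sub₀ (p : ℚ) hp' (show δ ≤ M by lia)] <;>
    simp only [pow_add, mul_comm _ δ, mul_comm _ M, pow_mul] <;>
    field_simp <;> ring

end Frequencies

section ExcessCount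

variable {F K : Type*} [Field F] [DecidableEq F] [Field K] [Fintype K] [Algebra F K]
  {σ : K ≃ₐ[F] K} {Q N : ℕ}

theorem excess_zero : excess σ (0 : K × K) = Fintype.card K := by
  simp [excess, twistedForm]

variable [DecidableEq K]

/-- The number of nonzero pairs `a` whose form has excess `(-Q) ^ (N + i)`. -/
def excessCount (σ : K ≃ₐ[F] K) (Q N : ℕ) (i : Fin 4) : ℕ :=
  #{a ∈ (univ : Finset (K × K)).erase 0 | excess σ a = (-(Q : ℤ)) ^ (N + i)}

theorem neg_natCast_pow_injective (hQ : 1 < Q) : Function.Injective fun n : ℕ => (-(Q : ℤ)) ^ n :=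
  fun m n hmn => Nat.pow_right_injective hQ <| by
    simpa [Int.natAbs_pow] using congrArg Int.natAbs hmn

theorem sum_erase_eq_sum_excessCount (hQ : 1 < Q)
    (hex : ∀ a : K × K, a ≠ 0 → ∃ i : Fin 4, excess σ a = (-(Q : ℤ)) ^ (N + i))
    {M : Type*} [AddCommMonoid M] (G : K × K → M) (g : Fin 4 → M)
    (hG : ∀ (a : K × K) (i : Fin 4), excess σ a = (-(Q : ℤ)) ^ (N + i) → G a = g i) :
    ∑ a ∈ (univ : Finset (K × K)).erase 0, G a = ∑ i, excessCount σ Q N i • g i := by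
  have hmem : ∀ a ∈ (univ : Finset (K × K)).erase 0, excess σ a ∈
      univ.image fun i : Fin 4 => (-(Q : ℤ)) ^ (N + i) := fun a ha => by
    simpa [eq_comm] using hex a (ne_of_mem_erase ha)
  have hinj : Function.Injective fun i : Fin 4 => (-(Q : ℤ)) ^ (N + i) := fun i j hij =>
    Fin.ext (add_left_cancel (neg_natCast_pow_injective hQ hij))
  rw [← sum_fiberwise_of_maps_to hmem, sum_image hinj.injOn]
  exact sum_congr rfl fun i _ => sum_eq_card_nsmul fun a ha => hG a i (mem_filter.1 ha).2

theorem sum_excessCount_mul_pow (hQ : 1 < Q)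
    (hex : ∀ a : K × K, a ≠ 0 → ∃ i : Fin 4, excess σ a = (-(Q : ℤ)) ^ (N + i)) (k : ℕ) :
    ∑ i : Fin 4, (excessCount σ Q N i : ℤ) * ((-(Q : ℤ)) ^ (N + i)) ^ k =
      ∑ a, excess σ a ^ k - (Fintype.card K : ℤ) ^ k := by
  rw [← add_sum_erase _ _ (mem_univ (0 : K × K)), excess_zero, add_sub_cancel_left,
    sum_erase_eq_sum_excessCount hQ hex _ _ fun a i hi => congrArg (· ^ k) hi]
  simp only [nsmul_eq_mul]

theorem NormRegular.excessCount_eq (h : NormRegular σ Q) (hF : (2 : F) ≠ 0)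
    (hQ : 1 < Q) (hE : #{x : K | σ (σ x) = x} = Q ^ 2) (hK : Fintype.card K = Q ^ (2 * N))
    (i : Fin 4) :
    ((Q : ℚ) + 1) * (Q ^ 2 - 1) * (Q ^ 3 + 1) * excessCount σ Q N i =
      momentSolution (Q : ℚ) ((-Q) ^ N) i := by
  have hmoment (k : ℕ) : ((-(Q : ℚ)) ^ N) ^ k *
      ∑ i : Fin 4, (excessCount σ Q N i : ℚ) * ((-(Q : ℚ)) ^ (i : ℕ)) ^ k =
        (∑ a, excess σ a ^ k : ℤ) - (Fintype.card K : ℚ) ^ k := by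
    have hsum := congrArg (Int.cast (R := ℚ)) <|
      sum_excessCount_mul_pow hQ (fun a ha => h.exists_excess_eq hF hQ hE hK ha) k
    push_cast at hsum ⊢
    rw [← hsum, mul_sum]
    exact sum_congr rfl fun i _ => by rw [pow_add, mul_pow]; ring
  have hQ0 : (Q : ℚ) ≠ 0 := by positivity
  have hT0 : (-(Q : ℚ)) ^ N ≠ 0 := pow_ne_zero _ (neg_ne_zero.2 hQ0)
  have hKT : (Fintype.card K : ℚ) = ((-(Q : ℚ)) ^ N) ^ 2 := by
    rw [hK, Nat.cast_pow, ← pow_mul, mul_comm N, (even_two_mul N).neg_pow]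
  have h₀ := hmoment 0
  have h₁ := hmoment 1
  have h₂ := hmoment 2
  have h₃ := hmoment 3
  simp only [pow_zero, sum_const, card_univ, Fintype.card_prod, nsmul_one, mul_one, one_mul] at h₀
  simp only [pow_one, h.sum_excess] at h₁
  rw [h.sum_excess_sq] at h₂
  rw [h.sum_excess_cube hE] at h₃
  push_cast [hKT] at h₀ h₁ h₂ h₃
  generalize (-(Q : ℚ)) ^ N = T at *
  refine eq_momentSolution (f := fun i => (excessCount σ Q N i : ℚ)) hQ0 ?_ ?_ ?_ ?_ i
  · linear_combination h₀
  · exact mul_left_cancel₀ hT0 (by linear_combination h₁)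
  · exact mul_left_cancel₀ (pow_ne_zero 2 hT0) (by linear_combination h₂)
  · exact mul_left_cancel₀ (pow_ne_zero 3 hT0) (by linear_combination h₃)

end ExcessCount

section Enumerator

variable {ι F : Type*} [Fintype ι] [Fintype F] [DecidableEq F]

theorem comp_apply (v : ι → F) (u : F) : comp v u = #{j | v j = u} := rfl

theorem comp_mem_finsuppAntidiag (v : ι → F) :
    comp v ∈ finsuppAntidiag (univ : Finset F) (Fintype.card ι) := by
  rw [mem_finsuppAntidiag]
  exact ⟨(card_eq_sum_card_fiberwise fun j _ => mem_univ (v j)).symm, subset_univ _⟩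

variable [Field F]

theorem completeWeightEnumerator_eq_sum {A : Type*} [Fintype A] {C : Submodule F (ι → F)}
    {W : A → ι → F} (hW : Function.Injective W) (hC : (C : Set (ι → F)) = Set.range W) :
    completeWeightEnumerator C = ∑ a, MvPolynomial.monomial (comp (W a)) (1 : ℚ) := by
  classical
  rw [completeWeightEnumerator,
    ← sum_fiberwise_of_maps_to fun a _ => comp_mem_finsuppAntidiag (W a)]
  refine sum_congr rfl fun t _ => ?_
  have hcount : {c | c ∈ C ∧ comp c = t} = W '' ({a | comp (W a) = t} : Finset A) := by
    ext c
    simp only [← SetLike.mem_coe, hC, Set.mem_range, Set.mem_image, coe_filter_univ]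
    constructor
    · rintro ⟨⟨a, rfl⟩, ha⟩
      exact ⟨a, ha, rfl⟩
    · rintro ⟨a, ha, rfl⟩
      exact ⟨⟨a, rfl⟩, ha⟩
  rw [hcount, Set.ncard_image_of_injective _ hW, Set.ncard_coe_finset,
    sum_eq_card_nsmul fun a ha => by rw [(mem_filter.1 ha).2], ← map_nsmul, nsmul_one]

theorem monomial_comp_eq {v : ι → F} {a b : ℕ} (ha : comp v 0 = a) (hb : ∀ u ≠ 0, comp v u = b) :
    MvPolynomial.monomial (comp v) (1 : ℚ) =
      MvPolynomial.X 0 ^ a * ∏ u ∈ (univ : Finset F).erase 0, MvPolynomial.X u ^ b := by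
  rw [MvPolynomial.monomial_eq, map_one, one_mul, Finsupp.prod_fintype _ _ (by simp),
    ← mul_prod_erase _ _ (mem_univ (0 : F)), ha]
  congr 1
  exact prod_congr rfl fun u hu => by rw [hb u (ne_of_mem_erase hu)]

end Enumerator

section TwistedWord

variable {F K : Type*} [Field F] [Field K] [Algebra F K]

/-- The word of values of `twistedForm σ a` on the nonzero elements of `K`. -/
def twistedWord (σ : K ≃ₐ[F] K) (a : K × K) : Kˣ → F :=
  fun x => twistedForm σ a x

theorem twistedForm_sub (σ : K ≃ₐ[F] K) (a b : K × K) (x : K) :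
    twistedForm σ (a - b) x = twistedForm σ a x - twistedForm σ b x := by
  simp only [twistedForm, Prod.fst_sub, Prod.snd_sub, sub_mul, map_sub, map_add]
  ring

theorem twistedWord_zero (σ : K ≃ₐ[F] K) : twistedWord σ 0 = 0 := by
  ext x
  simp [twistedWord, twistedForm]

variable [DecidableEq F] [Fintype K] {σ : K ≃ₐ[F] K} {Q N : ℕ}

theorem twistedWord_injective (hQ : 1 < Q) (hN : 4 ≤ N) (hK : Fintype.card K = Q ^ (2 * N))
    (hex : ∀ a : K × K, a ≠ 0 → ∃ i : Fin 4, excess σ a = (-(Q : ℤ)) ^ (N + i)) :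
    Function.Injective (twistedWord σ) := by
  intro a b hab
  by_contra hne
  have hzero (x : K) : twistedForm σ (a - b) x = 0 := by
    rw [twistedForm_sub, sub_eq_zero]
    obtain rfl | hx := eq_or_ne x 0
    · rw [twistedForm_zero, twistedForm_zero]
    · exact congrFun hab (Units.mk0 x hx)
  have hexcess : excess σ (a - b) = (-(Q : ℤ)) ^ (2 * N) := by
    rw [(even_two_mul N).neg_pow]
    simp [excess, hzero, hK]
  obtain ⟨i, hi⟩ := hex (a - b) (sub_ne_zero.2 hne)
  have hexponent : 2 * N = N + i := neg_natCast_pow_injective hQ (hexcess.symm.trans hi)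
  lia

variable [DecidableEq K] [Fintype F]

theorem NormRegular.comp_twistedWord (h : NormRegular σ Q) (a : K × K) {u : F} (hu : u ≠ 0) :
    comp (twistedWord σ a) u = #{x : K | twistedForm σ a x = 1} := by
  rw [← h.card_twistedForm_eq a hu, card_filter_units _ (by simpa [twistedForm_zero] using hu.symm)]
  rfl

theorem comp_twistedWord_zero_add_one (a : K × K) :
    comp (twistedWord σ a) 0 + 1 = #{x : K | twistedForm σ a x = 0} := by
  have hunits : comp (twistedWord σ a) 0 = #{x : K | x ≠ 0 ∧ twistedForm σ a x = 0} := by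
    rw [card_filter_units _ (by simp)]
    simp only [ne_eq, Units.ne_zero, not_false_eq_true, true_and]
    rfl
  rw [← card_erase_add_one (a := 0) (by simp [twistedForm_zero]), hunits]
  congr 2
  ext x
  simp

theorem monomial_comp_twistedWord_zero :
    MvPolynomial.monomial (comp (twistedWord σ 0)) (1 : ℚ) =
      MvPolynomial.X 0 ^ (Fintype.card K - 1) := by
  rw [monomial_comp_eq (a := Fintype.card K - 1) (b := 0)]
  · simp
  · simp [twistedWord_zero, comp_apply, Fintype.card_units]
  · intro u hu
    simp [twistedWord_zero, comp_apply, hu.symm]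

theorem NormRegular.monomial_comp_twistedWord (h : NormRegular σ Q) {a : K × K} {α β : ℕ}
    (hβ : (β : ℤ) * Fintype.card F = Fintype.card K - excess σ a)
    (hα : (α : ℤ) + 1 = β + excess σ a) :
    MvPolynomial.monomial (comp (twistedWord σ a)) (1 : ℚ) =
      MvPolynomial.X 0 ^ α * ∏ u ∈ (univ : Finset F).erase 0, MvPolynomial.X u ^ β := by
  have hone : #{x : K | twistedForm σ a x = 1} = β := by
    have hF : (Fintype.card F : ℤ) ≠ 0 := by exact_mod_cast Fintype.card_ne_zero
    have hmul : (#{x : K | twistedForm σ a x = 1} : ℤ) * Fintype.card F = β * Fintype.card F := by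
      linear_combination h.excess_add_card a - hβ
    exact_mod_cast mul_right_cancel₀ hF hmul
  have hzero := comp_twistedWord_zero_add_one (σ := σ) a
  refine monomial_comp_eq ?_ fun u hu => (h.comp_twistedWord a hu).trans hone
  rw [excess, hone, ← hzero] at hα
  lia

theorem NormRegular.completeWeightEnumerator_eq (h : NormRegular σ Q) (hF : (2 : F) ≠ 0)
    (hQ : 1 < Q) (hN : 4 ≤ N) (hE : #{x : K | σ (σ x) = x} = Q ^ 2)
    (hK : Fintype.card K = Q ^ (2 * N)) {C : Submodule F (Kˣ → F)}
    (hC : (C : Set (Kˣ → F)) = Set.range (twistedWord σ)) {α β : Fin 4 → ℕ}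
    (hβ : ∀ i, (β i : ℤ) * Fintype.card F = Fintype.card K - (-(Q : ℤ)) ^ (N + i))
    (hα : ∀ i, (α i : ℤ) + 1 = β i + (-(Q : ℤ)) ^ (N + i)) :
    completeWeightEnumerator C = MvPolynomial.X 0 ^ (Fintype.card K - 1) +
      ∑ i, MvPolynomial.C (excessCount σ Q N i : ℚ) * (MvPolynomial.X 0 ^ α i *
        ∏ u ∈ (univ : Finset F).erase 0, MvPolynomial.X u ^ β i) := by
  have hex (a : K × K) (ha : a ≠ 0) := h.exists_excess_eq hF hQ hE hK ha
  rw [completeWeightEnumerator_eq_sum (twistedWord_injective hQ hN hK hex) hC,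
    ← add_sum_erase _ _ (mem_univ 0), monomial_comp_twistedWord_zero,
    sum_erase_eq_sum_excessCount hQ hex _ _ fun a i hi =>
      h.monomial_comp_twistedWord (hi ▸ hβ i) (hi ▸ hα i)]
  simp only [nsmul_eq_mul, map_natCast]

end TwistedWord

section Exponents

variable {q m ℓ N : ℕ}

theorem eq_gcd_mul_mSub (m ℓ : ℕ) : m = m.gcd ℓ * mSub m ℓ :=
  (Nat.mul_div_cancel' (Nat.gcd_dvd_left m ℓ)).symm

theorem pow_eq_gcd_pow (hN : mSub m ℓ = 2 * N) : q ^ m = (q ^ m.gcd ℓ) ^ (2 * N) := by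
  rw [← pow_mul, ← hN, ← eq_gcd_mul_mSub]

theorem half_eq_gcd_mul (hN : mSub m ℓ = 2 * N) : m / 2 = m.gcd ℓ * N :=
  Nat.div_eq_of_eq_mul_right two_pos (by conv_lhs => rw [eq_gcd_mul_mSub m ℓ, hN, mul_left_comm])

theorem eps_eq (hN : mSub m ℓ = 2 * N) : eps m ℓ = (-1) ^ N := by
  rw [eps, hN, Nat.mul_div_cancel_left _ two_pos]

theorem neg_pow_eq_eps (hN : mSub m ℓ = 2 * N) (i : ℕ) :
    (-((q ^ m.gcd ℓ : ℕ) : ℤ)) ^ (N + i) =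
      (-1) ^ i * eps m ℓ * (q : ℤ) ^ (m / 2 + i * m.gcd ℓ) := by
  rw [eps_eq hN, half_eq_gcd_mul hN, neg_pow, Nat.cast_pow, ← pow_mul]
  ring

theorem expB_mul (hN : mSub m ℓ = 2 * N) (hm : 1 < m) (i : Fin 4) :
    expB q m ℓ i * q = ((q ^ m : ℕ) : ℤ) - (-((q ^ m.gcd ℓ : ℕ) : ℤ)) ^ (N + i) := by
  have hhalf : m / 2 + i * m.gcd ℓ ≠ 0 :=
    (Nat.add_pos_left (Nat.div_pos hm two_pos) _).ne'
  rw [neg_pow_eq_eps hN, expB, ← pow_sub_one_mul hhalf, Nat.cast_pow,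
    ← pow_sub_one_mul (by lia : m ≠ 0)]
  ring

theorem expA_add_one (hN : mSub m ℓ = 2 * N) (hm : 1 < m) (i : Fin 4) :
    expA q m ℓ i + 1 = expB q m ℓ i + (-((q ^ m.gcd ℓ : ℕ) : ℤ)) ^ (N + i) := by
  have hhalf : m / 2 + i * m.gcd ℓ ≠ 0 :=
    (Nat.add_pos_left (Nat.div_pos hm two_pos) _).ne'
  rw [neg_pow_eq_eps hN, expA, expB, ← pow_sub_one_mul hhalf]
  ring

theorem abs_neg_pow_mul_le (hN : mSub m ℓ = 2 * N) (hN4 : 4 ≤ N) (hδ : m.gcd ℓ ≠ 0) (hq : 0 < q)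
    (i : Fin 4) : |(-((q ^ m.gcd ℓ : ℕ) : ℤ)) ^ (N + i)| * q ≤ (q ^ m : ℕ) := by
  have hexp : m.gcd ℓ * (N + i) + 1 ≤ m := by
    conv_rhs => rw [eq_gcd_mul_mSub m ℓ, hN]
    have hi : N + i + 1 ≤ 2 * N := by lia
    nlinarith [Nat.pos_of_ne_zero hδ]
  rw [abs_pow, abs_neg, Nat.abs_cast, Nat.cast_pow, ← pow_mul, ← pow_succ, Nat.cast_pow]
  exact pow_le_pow_right₀ (by exact_mod_cast hq) hexp

theorem expB_nonneg (hN : mSub m ℓ = 2 * N) (hN4 : 4 ≤ N) (hm : 1 < m) (hq : 0 < q) (i : Fin 4) :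
    0 ≤ expB q m ℓ i := by
  have hq' : (0 : ℤ) < q := by exact_mod_cast hq
  have habs := abs_neg_pow_mul_le hN hN4 (Nat.gcd_ne_zero_left (by lia)) hq i
  refine nonneg_of_mul_nonneg_left ?_ hq'
  rw [expB_mul hN hm]
  nlinarith [le_abs_self ((-((q ^ m.gcd ℓ : ℕ) : ℤ)) ^ (N + i)),
    abs_nonneg ((-((q ^ m.gcd ℓ : ℕ) : ℤ)) ^ (N + i))]

theorem expA_nonneg (hN : mSub m ℓ = 2 * N) (hN4 : 4 ≤ N) (hm : 1 < m) (hq : 0 < q) (i : Fin 4) :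
    0 ≤ expA q m ℓ i := by
  have hq' : (0 : ℤ) < q := by exact_mod_cast hq
  have habs := abs_neg_pow_mul_le hN hN4 (Nat.gcd_ne_zero_left (by lia)) hq i
  have hne : (-((q ^ m.gcd ℓ : ℕ) : ℤ)) ^ (N + i) ≠ 0 :=
    pow_ne_zero _ (neg_ne_zero.2 (by exact_mod_cast (pow_pos hq _).ne'))
  suffices 0 < expA q m ℓ i + 1 by lia
  refine pos_of_mul_pos_left ?_ hq'.le
  rw [expA_add_one hN hm, add_mul, expB_mul hN hm]
  nlinarith [neg_abs_le ((-((q ^ m.gcd ℓ : ℕ) : ℤ)) ^ (N + i)), abs_pos.2 hne]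

end Exponents

section Code

variable (F K : Type*) [Field F] [Fintype F] [Field K] [Fintype K] [Algebra F K]

/-- The `ℓ`-th power of the Frobenius automorphism `x ↦ x ^ |F|` of a finite extension `K` of the
finite field `F`. -/
def frobPow (ℓ : ℕ) : K ≃ₐ[F] K :=
  FiniteField.frobeniusAlgEquivOfAlgebraic F K ^ ℓ

variable {F K} {q m ℓ N : ℕ}

theorem frobPow_apply (hq : Fintype.card F = q) (x : K) : frobPow F K ℓ x = x ^ q ^ ℓ := by
  rw [frobPow, AlgEquiv.coe_pow, FiniteField.coe_frobeniusAlgEquivOfAlgebraic_iterate, hq]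

theorem orderOf_frobPow (hq : Fintype.card F = q) (hK : Fintype.card K = q ^ m) :
    orderOf (frobPow F K ℓ) = mSub m ℓ := by
  have hrank : Module.finrank F K = m :=
    Nat.pow_right_injective (hq ▸ Fintype.one_lt_card : 1 < q)
      (by simp only [← hK, Module.card_eq_pow_finrank (K := F) (V := K), hq])
  rw [frobPow, orderOf_pow, FiniteField.orderOf_frobeniusAlgEquivOfAlgebraic, hrank, mSub]

theorem word_smul_add_smul (hq : Fintype.card F = q) (a : K × K) :
    word F K (a.1 • (X : K[X]) ^ q ^ ℓ + a.2 • (X : K[X]) ^ q ^ (3 * ℓ)) =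
      twistedWord (frobPow F K ℓ) a := by
  funext x
  simp only [word, LinearMap.coe_mk, AddHom.coe_mk, twistedWord, twistedForm, frobPow_apply hq,
    eval_add, eval_smul, eval_pow, eval_X, smul_eq_mul]
  congr 1
  ring

theorem coe_code_familyL (hq : Fintype.card F = q) :
    (code F (familyL K q ℓ) : Set (Kˣ → F)) = Set.range (twistedWord (frobPow F K ℓ)) := by
  ext c
  simp only [code, familyL, SetLike.mem_coe, Submodule.mem_map, Submodule.restrictScalars_mem,
    Submodule.mem_span_pair, Set.mem_range, ← word_smul_add_smul hq]
  constructor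
  · rintro ⟨_, ⟨a, b, rfl⟩, rfl⟩
    exact ⟨(a, b), rfl⟩
  · rintro ⟨a, rfl⟩
    exact ⟨_, ⟨a.1, a.2, rfl⟩, rfl⟩

variable [DecidableEq K]

theorem card_fixed_frobPow_sq (hq : Fintype.card F = q) (hK : Fintype.card K = q ^ m)
    (hN : mSub m ℓ = 2 * N) (hN0 : N ≠ 0) :
    #{x : K | frobPow F K ℓ (frobPow F K ℓ x) = x} = (q ^ m.gcd ℓ) ^ 2 :=
  card_fixed_sq_of_orderOf hN0 ((orderOf_frobPow hq hK).trans hN) (hK.trans (pow_eq_gcd_pow hN))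

theorem normRegular_frobPow (hq : Fintype.card F = q) (hK : Fintype.card K = q ^ m)
    (hN : mSub m ℓ = 2 * N) (hN0 : N ≠ 0) : NormRegular (frobPow F K ℓ) (q ^ m.gcd ℓ) :=
  normRegular_of_card_fixed
    (card_fixed_of_orderOf (mul_ne_zero two_ne_zero hN0) ((orderOf_frobPow hq hK).trans hN)
      (hK.trans (pow_eq_gcd_pow hN)))
    (card_fixed_frobPow_sq hq hK hN hN0)

variable [DecidableEq F]

theorem excessCount_frobPow_eq_freq (hF : (2 : F) ≠ 0) (hq : Fintype.card F = q)
    (hK : Fintype.card K = q ^ m) (hN : mSub m ℓ = 2 * N) (hN2 : 2 ≤ N) (hδ : m.gcd ℓ ≠ 0)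
    (i : Fin 4) :
    (excessCount (frobPow F K ℓ) (q ^ m.gcd ℓ) N i : ℚ) = freq q m ℓ i := by
  have hq1 : 1 < q := hq ▸ Fintype.one_lt_card
  have hQ : 1 < q ^ m.gcd ℓ := Nat.one_lt_pow hδ hq1
  have heven : Even m := by
    rw [eq_gcd_mul_mSub m ℓ, hN]
    exact (even_two_mul N).mul_left _
  have hhalf : 2 * m.gcd ℓ ≤ m / 2 := by
    rw [half_eq_gcd_mul hN, mul_comm]
    exact Nat.mul_le_mul_left _ hN2
  have heps : ((eps m ℓ : ℤ) : ℚ) ^ 2 = 1 := by simp [eps_eq hN, ← pow_mul', pow_mul]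
  have hT : (-((q ^ m.gcd ℓ : ℕ) : ℚ)) ^ N = (eps m ℓ : ℤ) * (q : ℚ) ^ (m / 2) := by
    have hz := congrArg (Int.cast (R := ℚ)) (neg_pow_eq_eps (q := q) hN 0)
    simpa using hz
  have hN0 : N ≠ 0 := by lia
  rw [freq, eq_div_iff (freqDen_ne_zero hQ), mul_comm, freqDen_eq,
    freqNum_eq_momentSolution (by lia) heven hhalf heps, ← hT]
  exact_mod_cast (normRegular_frobPow hq hK hN hN0).excessCount_eq hF hQ
    (card_fixed_frobPow_sq hq hK hN hN0) (hK.trans (pow_eq_gcd_pow hN)) i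

end Code

end TraceCode

end

open TraceCode in
theorem corollary5p4_general {F K : Type*} [Field F] [Fintype F] [DecidableEq F] {q m ℓ : ℕ}
    (hq : Fintype.card F = q) (hF : (2 : F) ≠ 0) (heven : Even (mSub m ℓ)) (hlt : 6 * m.gcd ℓ < m)
    [Field K] [Fintype K] [DecidableEq K] [Algebra F K] (hK : Fintype.card K = q ^ m) :
    ∃ a b : Fin 4 → ℕ, (∀ i, (a i : ℤ) = expA q m ℓ i) ∧ (∀ i, (b i : ℤ) = expB q m ℓ i) ∧
      completeWeightEnumerator (code F (familyL K q ℓ)) =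
        MvPolynomial.X 0 ^ (q ^ m - 1) +
          ∑ i : Fin 4, MvPolynomial.C (freq q m ℓ i) *
            (MvPolynomial.X 0 ^ a i *
              ∏ u ∈ (Finset.univ : Finset F).erase 0, MvPolynomial.X u ^ b i) := by
  obtain ⟨N, hN⟩ := heven.two_dvd
  have hδ : m.gcd ℓ ≠ 0 := Nat.gcd_ne_zero_left (by lia)
  have hm : 1 < m := by lia
  have hN4 : 4 ≤ N := by
    have hmul : m.gcd ℓ * 6 < m.gcd ℓ * (2 * N) := by
      rwa [← hN, ← eq_gcd_mul_mSub, mul_comm]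
    have := Nat.lt_of_mul_lt_mul_left hmul
    lia
  have hN0 : N ≠ 0 := by lia
  have hq1 : 1 < q := hq ▸ Fintype.one_lt_card
  choose α hα using fun i => Int.eq_ofNat_of_zero_le (expA_nonneg hN hN4 hm hq1.le i)
  choose β hβ using fun i => Int.eq_ofNat_of_zero_le (expB_nonneg hN hN4 hm hq1.le i)
  refine ⟨α, β, fun i => (hα i).symm, fun i => (hβ i).symm, ?_⟩
  have henum := (normRegular_frobPow hq hK hN hN0).completeWeightEnumerator_eq hF
    (Nat.one_lt_pow hδ hq1) hN4 (card_fixed_frobPow_sq hq hK hN hN0)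
    (hK.trans (pow_eq_gcd_pow hN)) (coe_code_familyL hq)
    (fun i => by rw [← hβ, hq, hK, expB_mul hN hm])
    (fun i => by rw [← hα, ← hβ, expA_add_one hN hm])
  simpa only [excessCount_frobPow_eq_freq hF hq hK hN (by lia) hδ, hK] using henum

theorem corollary5p4 {p m ℓ : ℕ} [Fact p.Prime] (hp : p ≠ 2) (hm : 0 < m) (hℓ : 0 < ℓ)
    (heven : Even (TraceCode.mSub m ℓ)) (hlt : 6 * ℓ < m)
    {K : Type*} [Field K] [Fintype K] [DecidableEq K] [Algebra (ZMod p) K]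
    (hK : Fintype.card K = p ^ m) :
    ∃ a b : Fin 4 → ℕ,
      (∀ i, (a i : ℤ) = TraceCode.expA p m ℓ i) ∧
      (∀ i, (b i : ℤ) = TraceCode.expB p m ℓ i) ∧
      TraceCode.completeWeightEnumerator
          (TraceCode.code (ZMod p) (TraceCode.familyL K p ℓ)) =
        MvPolynomial.X 0 ^ (p ^ m - 1) +
          ∑ i : Fin 4, MvPolynomial.C (TraceCode.freq p m ℓ i) *
            (MvPolynomial.X 0 ^ a i *
              ∏ u ∈ (Finset.univ : Finset (ZMod p)).erase 0, MvPolynomial.X u ^ b i) :=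
  corollary5p4_general (ZMod.card p) (by exact_mod_cast ZMod.prime_ne_zero p 2 hp) heven
    ((Nat.mul_le_mul_left 6 (Nat.gcd_le_right m hℓ)).trans_lt hlt) hK
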